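/- Let $\mathbb{K}$ be a field of characteristic zero. An oriented symmetric graph with $n$ vertices is a finite multiset of ordered pairs $[i,j]$ (its oriented edges) with $i,j\in\{1,\dots,n\}$. Let $C_n$ be the $\mathbb{K}$-vector space spanned by the oriented symmetric graphs with $n$ vertices, modulo the relations $G=-G'$ whenever $G'$ is obtained from $G$ by reversing one edge (so graphs with a loop vanish). For an edge $e=[i,j]$ with $i\ne j$ let $G/e$ be the graph with $n-1$ vertices obtained from $G$ by removing $e$, merging the vertex $\max(i,j)$ into $\min(i,j)$, and lowering by one the labels greater than $\max(i,j)$. Put $\epsilon(e)=1$ if $i<j$ and $\epsilon(e)=-1$ if $i>j$. The symmetric graph complex is $(C_*,\delta)$ with $$\delta(G)=\sum_{e=[i,j]}(-1)^{\max(i,j)}\,\epsilon(e)\,G/e ,$$ the sum running over all edges of $G$ that are not loops, counted with multiplicity. A polygon is a connected symmetric graph without loops all of whose vertices have valency $2$. The polygons span a subcomplex $\mathbb{K}[P]\subset (C_*,\delta)$, and this subcomplex is acyclic: $$H_n(\mathbb{K}[P])=0\qquad\text{for all } n\ge 0 .$$ -/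

import Mathlib

open CategoryTheory

namespace SymGraph

universe u

/-- An oriented symmetric graph with the ordered vertex set `{1, …, n}` (modelled by `Fin n`, so that
the index `v : Fin n` stands for the vertex `v + 1`), up to isomorphism: the finite multiset of its
oriented edges `[i, j]`. -/
abbrev OrientedGraph (n : ℕ) : Type := Multiset (Fin n × Fin n)

/-- The standardisation map of the contraction of an edge joining `i ≠ j`, on numbers: `max i j` is
sent to `min i j`, and the numbers above `max i j` are shifted down by one. -/
def stdNat (i j k : ℕ) : ℕ :=
  if k = max i j then min i j else if k < max i j then k else k - 1

/-- The standardisation map of the contraction of an edge joining the vertices `i ≠ j`. -/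
def std {n : ℕ} (i j : Fin (n + 1)) (h : i ≠ j) (k : Fin (n + 1)) : Fin n :=
  ⟨stdNat i j k, by
    have h' : (i : ℕ) ≠ j := fun e => h (Fin.ext e)
    have := i.2; have := j.2; have := k.2
    unfold stdNat
    split_ifs <;> omega⟩

/-- The image of the edge `f` when an edge joining `i ≠ j` is contracted. -/
def stdEdge {n : ℕ} (i j : Fin (n + 1)) (h : i ≠ j) (f : Fin (n + 1) × Fin (n + 1)) :
    Fin n × Fin n :=
  (std i j h f.1, std i j h f.2)

/-- The contraction `G / e` of the edge `e` (which is not a loop) of `G`: one copy of `e` is removed and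
the standardisation map is applied to the remaining edges. -/
def contract {n : ℕ} (G : OrientedGraph (n + 1)) (e : Fin (n + 1) × Fin (n + 1)) (h : e.1 ≠ e.2) :
    OrientedGraph n :=
  (G.erase e).map (stdEdge e.1 e.2 h)

/-- The sign `ε(e)` of the oriented edge `e = [i, j]`. -/
def edgeSign {n : ℕ} (e : Fin n × Fin n) : ℤ := if e.2 < e.1 then -1 else 1

/-- The integer `(-1) ^ max(i, j) * ε(e)` for an oriented edge `e = [i, j]`; the vertices are
numbered from `1`, hence the shift by one. -/
def edgeCoeff {n : ℕ} (e : Fin n × Fin n) : ℤ :=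
  (-1) ^ (max (e.1 : ℕ) (e.2 : ℕ) + 1) * edgeSign e

noncomputable section Chains

variable (K : Type u) [Field K]

/-- The span of all `G + G'`, where `G'` is obtained from `G` by reversing one edge. -/
def orientationRel (n : ℕ) : Submodule K (OrientedGraph n →₀ K) :=
  Submodule.span K {x | ∃ (e : Fin n × Fin n) (s : OrientedGraph n),
    x = Finsupp.single (e ::ₘ s) 1 + Finsupp.single (e.swap ::ₘ s) 1}

/-- The chain module of graphs with `n` vertices: the vector space on the oriented graphs with `n`
vertices modulo `G ∼ -G'` whenever `G'` is `G` with one edge reversed. In characteristic zero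
the graphs with a loop vanish in it (see `graphClass_eq_zero`). -/
abbrev GraphSpace (n : ℕ) : Type u := (OrientedGraph n →₀ K) ⧸ orientationRel K n

/-- The class of an oriented graph. -/
def graphClass {n : ℕ} (G : OrientedGraph n) : GraphSpace K n :=
  (orientationRel K n).mkQ (Finsupp.single G 1)

/-- The contribution of the edge `e` of `G` to the differential of `G`; loops do not contribute. -/
def edgeTerm {n : ℕ} (G : OrientedGraph (n + 1)) (e : Fin (n + 1) × Fin (n + 1)) :
    GraphSpace K n :=
  if h : e.1 ≠ e.2 then (edgeCoeff e : K) • graphClass K (contract G e h) else 0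

/-- `δ(G) = ∑_e (-1)^max(i,j) ε(e) G/e`, the sum over all edges `e = [i, j]` of `G` (with
multiplicity). -/
def deltaGraph {n : ℕ} (G : OrientedGraph (n + 1)) : GraphSpace K n :=
  (G.map (edgeTerm K G)).sum

variable {K}

theorem graphClass_swap {n : ℕ} (e : Fin n × Fin n) (s : OrientedGraph n) :
    graphClass K (e.swap ::ₘ s) = - graphClass K (e ::ₘ s) := by
  rw [eq_neg_iff_add_eq_zero, add_comm]
  unfold graphClass
  rw [← map_add, Submodule.mkQ_apply, Submodule.Quotient.mk_eq_zero]
  exact Submodule.subset_span ⟨e, s, rfl⟩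

theorem graphClass_eq_zero [CharZero K] {n : ℕ} (G : OrientedGraph n) (e : Fin n × Fin n)
    (he : e ∈ G) (hl : e.1 = e.2) : graphClass K G = 0 := by
  obtain ⟨s, rfl⟩ := Multiset.exists_cons_of_mem he
  have h := graphClass_swap (K := K) e s
  have hs : e.swap = e := Prod.ext hl.symm hl
  rw [hs] at h
  have h2 : (2 : K) • graphClass K (e ::ₘ s) = 0 := by
    rw [two_smul]
    nth_rewrite 1 [h]
    exact neg_add_cancel _
  exact (smul_eq_zero.mp h2).resolve_left two_ne_zero

theorem std_comm {n : ℕ} (i j : Fin (n + 1)) (h : i ≠ j) : std j i h.symm = std i j h := by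
  funext k
  apply Fin.ext
  simp only [std, stdNat, max_comm, min_comm]

theorem edgeCoeff_swap {n : ℕ} (e : Fin n × Fin n) (h : e.1 ≠ e.2) :
    edgeCoeff e.swap = - edgeCoeff e := by
  unfold edgeCoeff edgeSign
  rcases lt_or_gt_of_ne h with h | h
  · simp [h, h.not_gt, max_comm]
  · simp [h, h.not_gt, max_comm]

theorem edgeTerm_cons_self_swap {n : ℕ} (e : Fin (n + 1) × Fin (n + 1))
    (s : OrientedGraph (n + 1)) :
    edgeTerm K (e.swap ::ₘ s) e.swap = - edgeTerm K (e ::ₘ s) e := by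
  by_cases h : e.1 ≠ e.2
  · have h' : e.swap.1 ≠ e.swap.2 := h.symm
    rw [edgeTerm, edgeTerm, dif_pos h, dif_pos h', edgeCoeff_swap e h]
    have : contract (e.swap ::ₘ s) e.swap h' = contract (e ::ₘ s) e h := by
      unfold contract
      rw [Multiset.erase_cons_head, Multiset.erase_cons_head]
      congr 1
      funext f
      simp only [stdEdge, Prod.fst_swap, Prod.snd_swap, std_comm e.1 e.2 h]
    rw [this]
    push_cast
    rw [neg_smul]
  · have h' : ¬ e.swap.1 ≠ e.swap.2 := fun g => h g.symm
    rw [edgeTerm, edgeTerm, dif_neg h, dif_neg h', neg_zero]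

theorem edgeTerm_cons_swap {n : ℕ} (e f : Fin (n + 1) × Fin (n + 1))
    (s : OrientedGraph (n + 1)) (hf : f ∈ s) :
    edgeTerm K (e.swap ::ₘ s) f = - edgeTerm K (e ::ₘ s) f := by
  by_cases h : f.1 ≠ f.2
  · rw [edgeTerm, edgeTerm, dif_pos h, dif_pos h]
    unfold contract
    rw [Multiset.erase_cons_tail_of_mem hf, Multiset.erase_cons_tail_of_mem hf,
      Multiset.map_cons, Multiset.map_cons, ← smul_neg, ← graphClass_swap]
    rfl
  · rw [edgeTerm, edgeTerm, dif_neg h, dif_neg h, neg_zero]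

theorem deltaGraph_swap {n : ℕ} (e : Fin (n + 1) × Fin (n + 1)) (s : OrientedGraph (n + 1)) :
    deltaGraph K (e.swap ::ₘ s) = - deltaGraph K (e ::ₘ s) := by
  unfold deltaGraph
  rw [Multiset.map_cons, Multiset.map_cons, Multiset.sum_cons, Multiset.sum_cons,
    edgeTerm_cons_self_swap, neg_add,
    Multiset.map_congr rfl (fun f hf => edgeTerm_cons_swap (K := K) e f s hf),
    Multiset.sum_map_neg]

variable (K)

/-- The differential `δ` from graphs with `n + 1` vertices to graphs with `n` vertices. -/
def delta (n : ℕ) : GraphSpace K (n + 1) →ₗ[K] GraphSpace K n :=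
  (orientationRel K (n + 1)).liftQ (Finsupp.linearCombination K (deltaGraph K)) (by
    unfold orientationRel
    rw [Submodule.span_le]
    rintro x ⟨e, s, rfl⟩
    change Finsupp.linearCombination K (deltaGraph K) _ = 0
    rw [map_add, Finsupp.linearCombination_single,
      Finsupp.linearCombination_single, deltaGraph_swap, one_smul, one_smul, add_neg_cancel])

variable {K}

theorem delta_graphClass {n : ℕ} (G : OrientedGraph (n + 1)) :
    delta K n (graphClass K G) = deltaGraph K G := by
  unfold delta graphClass
  rw [Submodule.mkQ_apply, Submodule.liftQ_apply]
  simp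

theorem graphSpace_ext {n : ℕ} {M : Type*} [AddCommGroup M] [Module K M]
    {f g : GraphSpace K n →ₗ[K] M} (h : ∀ G, f (graphClass K G) = g (graphClass K G)) : f = g := by
  apply Submodule.linearMap_qext
  apply Finsupp.lhom_ext'
  intro G
  apply LinearMap.ext_ring
  exact h G

theorem std_spec {n : ℕ} (i j : Fin (n + 1)) (h : i ≠ j) (k : Fin (n + 1)) :
    ((k : ℕ) = max (i : ℕ) j ∧ (std i j h k : ℕ) = min (i : ℕ) j) ∨
    ((k : ℕ) < max (i : ℕ) j ∧ (std i j h k : ℕ) = k) ∨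
    (max (i : ℕ) j < k ∧ (std i j h k : ℕ) + 1 = k) := by
  simp only [std, stdNat]
  split_ifs <;> omega

theorem stdNat_comm (i j k : ℕ) : stdNat i j k = stdNat j i k := by
  simp only [stdNat, max_comm, min_comm]

theorem stdNat_spec {i j : ℕ} (h : i < j) (k : ℕ) :
    (k = j ∧ stdNat i j k = i) ∨ (k < j ∧ stdNat i j k = k) ∨
    (j < k ∧ stdNat i j k + 1 = k) := by
  simp only [stdNat, max_eq_right h.le, min_eq_left h.le]
  split_ifs <;> omega

theorem stdNat_stdNat_aux {i j k l : ℕ} (h : i < j) (h' : k < l) (hjl : j ≤ l)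
    (h1 : stdNat i j k ≠ stdNat i j l) (x : ℕ) :
    stdNat (stdNat i j k) (stdNat i j l) (stdNat i j x) =
      stdNat (stdNat k l i) (stdNat k l j) (stdNat k l x) := by
  have a1 := stdNat_spec h k
  have a2 := stdNat_spec h l
  have a4 := stdNat_spec h' i
  have a5 := stdNat_spec h' j
  rcases hjl.lt_or_eq with hjl | rfl
  · have ei : stdNat k l i = i := by omega
    have ej : stdNat k l j = j := by omega
    have el : stdNat i j l = l - 1 := by omega
    have hk : stdNat i j k < l - 1 := by omega
    rw [ei, ej, el]
    have a3 := stdNat_spec h x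
    have a6 := stdNat_spec h' x
    have a7 := stdNat_spec hk (stdNat i j x)
    have a8 := stdNat_spec h (stdNat k l x)
    rcases a3 with a3 | a3 | a3 <;> rcases a6 with a6 | a6 | a6 <;> omega
  · have ei : stdNat k j i = i := by omega
    have ej : stdNat k j j = k := by omega
    have el : stdNat i j j = i := by omega
    have ek : stdNat i j k = k := by omega
    rw [el, ek] at h1
    rw [ei, ej, el, ek]
    have a3 := stdNat_spec h x
    have a6 := stdNat_spec h' x
    rcases lt_or_gt_of_ne h1 with hk | hk
    · rw [stdNat_comm i k]
      have a7 := stdNat_spec hk (stdNat i j x)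
      have a8 := stdNat_spec hk (stdNat k j x)
      rcases a3 with a3 | a3 | a3 <;> rcases a6 with a6 | a6 | a6 <;> omega
    · rw [stdNat_comm k i]
      have a7 := stdNat_spec hk (stdNat i j x)
      have a8 := stdNat_spec hk (stdNat k j x)
      rcases a3 with a3 | a3 | a3 <;> rcases a6 with a6 | a6 | a6 <;> omega

theorem stdNat_stdNat_aux' {i j k l : ℕ} (h : i < j) (h' : k < l)
    (h1 : stdNat i j k ≠ stdNat i j l) (h2 : stdNat k l i ≠ stdNat k l j) (x : ℕ) :
    stdNat (stdNat i j k) (stdNat i j l) (stdNat i j x) =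
      stdNat (stdNat k l i) (stdNat k l j) (stdNat k l x) := by
  rcases le_total j l with hjl | hjl
  · exact stdNat_stdNat_aux h h' hjl h1 x
  · exact (stdNat_stdNat_aux h' h hjl h2 x).symm

theorem stdNat_stdNat {i j k l : ℕ} (h : i ≠ j) (h' : k ≠ l)
    (h1 : stdNat i j k ≠ stdNat i j l) (h2 : stdNat k l i ≠ stdNat k l j) (x : ℕ) :
    stdNat (stdNat i j k) (stdNat i j l) (stdNat i j x) =
      stdNat (stdNat k l i) (stdNat k l j) (stdNat k l x) := by
  have c : ∀ a b : ℕ, stdNat a b = stdNat b a := fun a b => funext (stdNat_comm a b)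
  rcases lt_or_gt_of_ne h with h | h <;> rcases lt_or_gt_of_ne h' with h' | h'
  · exact stdNat_stdNat_aux' h h' h1 h2 x
  · rw [c k l] at h2 ⊢
    rw [c (stdNat i j k)]
    exact stdNat_stdNat_aux' h h' h1.symm h2 x
  · rw [c i j] at h1 ⊢
    rw [c (stdNat k l i)]
    exact stdNat_stdNat_aux' h h' h1 h2.symm x
  · rw [c i j] at h1 ⊢
    rw [c k l] at h2 ⊢
    rw [c (stdNat l k i), c (stdNat j i k)]
    exact stdNat_stdNat_aux' h h' h1.symm h2.symm x

theorem std_std {n : ℕ} (i j k l : Fin (n + 2)) (h : i ≠ j) (h' : k ≠ l)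
    (h1 : std i j h k ≠ std i j h l) (h2 : std k l h' i ≠ std k l h' j) (x : Fin (n + 2)) :
    std (std i j h k) (std i j h l) h1 (std i j h x) =
      std (std k l h' i) (std k l h' j) h2 (std k l h' x) :=
  Fin.ext (stdNat_stdNat (fun e => h (Fin.ext e)) (fun e => h' (Fin.ext e))
    (fun e => h1 (Fin.ext e)) (fun e => h2 (Fin.ext e)) x)

theorem edgeCoeff_stdEdge {n : ℕ} (i j k l : Fin (n + 2)) (h : i ≠ j) (h' : k ≠ l)
    (h1 : std i j h k ≠ std i j h l) (h2 : std k l h' i ≠ std k l h' j) :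
    edgeCoeff (i, j) * edgeCoeff (std i j h k, std i j h l) =
      - (edgeCoeff (k, l) * edgeCoeff (std k l h' i, std k l h' j)) := by
  have key : ∀ {m : ℕ} (a b : Fin m), edgeCoeff (a, b) =
      (-1) ^ (max (a : ℕ) (b : ℕ) + 1 + if (b : ℕ) < a then 1 else 0) := by
    intro m a b
    unfold edgeCoeff edgeSign
    by_cases hab : b < a
    · simp [hab, pow_succ]
    · simp [hab]
  rw [key, key, key, key, ← pow_add, ← pow_add]
  have par : ∀ a b : ℕ, (a + b) % 2 = 1 → (-1 : ℤ) ^ a = - (-1) ^ b := by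
    intro a b hab
    rcases Nat.even_or_odd a with ha | ha
    · have hb : Odd b := by rw [Nat.odd_iff]; rw [Nat.even_iff] at ha; omega
      rw [ha.neg_one_pow, hb.neg_one_pow, neg_neg]
    · have hb : Even b := by rw [Nat.even_iff]; rw [Nat.odd_iff] at ha; omega
      rw [ha.neg_one_pow, hb.neg_one_pow]
  apply par
  have e : (i : ℕ) ≠ j := fun e => h (Fin.ext e)
  have e' : (k : ℕ) ≠ l := fun e => h' (Fin.ext e)
  have e1 : (std i j h k : ℕ) ≠ std i j h l := fun e => h1 (Fin.ext e)
  have e2 : (std k l h' i : ℕ) ≠ std k l h' j := fun e => h2 (Fin.ext e)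
  have a1 := std_spec _ _ h k
  have a2 := std_spec _ _ h l
  have a4 := std_spec _ _ h' i
  have a5 := std_spec _ _ h' j
  rcases lt_or_gt_of_ne e with e | e <;> rcases lt_or_gt_of_ne e' with e' | e' <;>
    simp only [max_eq_left e.le, max_eq_right e.le, min_eq_left e.le, min_eq_right e.le,
      max_eq_left e'.le, max_eq_right e'.le, min_eq_left e'.le, min_eq_right e'.le]
      at a1 a2 a4 a5 <;>
    rcases a1 with a1 | a1 | a1 <;> rcases a2 with a2 | a2 | a2 <;> try omega
  all_goals rcases a4 with a4 | a4 | a4 <;> rcases a5 with a5 | a5 | a5 <;> try omega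
  all_goals split_ifs <;> omega

theorem sum_sum_erase_eq_zero {α M : Type*} [DecidableEq α] [AddCommGroup M]
    (T : α → α → Multiset α → M) (hT : ∀ a b s, T a b s + T b a s = 0) (G : Multiset α) :
    ∀ r : Multiset α,
      (G.map fun e => ((G.erase e).map fun f => T e f ((G.erase e).erase f + r)).sum).sum = 0 := by
  induction G using Multiset.induction_on with
  | empty => intro r; simp
  | cons a G ih =>
    intro r
    rw [Multiset.map_cons, Multiset.sum_cons, Multiset.erase_cons_head]
    have h1 : (G.map fun e => (((a ::ₘ G).erase e).map fun f =>
        T e f (((a ::ₘ G).erase e).erase f + r)).sum) =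
        G.map fun e => T e a (G.erase e + r) +
          ((G.erase e).map fun f => T e f ((G.erase e).erase f + (a ::ₘ r))).sum := by
      apply Multiset.map_congr rfl
      intro e he
      rw [Multiset.erase_cons_tail_of_mem he, Multiset.map_cons, Multiset.sum_cons,
        Multiset.erase_cons_head]
      congr 2
      apply Multiset.map_congr rfl
      intro f hf
      rw [Multiset.erase_cons_tail_of_mem hf, Multiset.cons_add, Multiset.add_cons]
    rw [h1, Multiset.sum_map_add, ih, add_zero, ← Multiset.sum_map_add]
    apply Multiset.sum_eq_zero
    intro x hx
    obtain ⟨f, -, rfl⟩ := Multiset.mem_map.mp hx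
    exact hT a f _

/-- The contribution to `δ (δ G)` of the contraction of `e` followed by that of `f`, where `s` is the
multiset of the remaining edges. -/
def twoTerm {n : ℕ} (e f : Fin (n + 2) × Fin (n + 2)) (s : OrientedGraph (n + 2)) :
    GraphSpace K n :=
  if h : e.1 ≠ e.2 then
    if h1 : std e.1 e.2 h f.1 ≠ std e.1 e.2 h f.2 then
      ((edgeCoeff e * edgeCoeff (stdEdge e.1 e.2 h f) : ℤ) : K) •
        graphClass K ((s.map (stdEdge e.1 e.2 h)).map (stdEdge _ _ h1))
    else 0
  else 0

theorem twoTerm_zero_of_loop {n : ℕ} (e f : Fin (n + 2) × Fin (n + 2)) (s : OrientedGraph (n + 2))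
    (h : ¬ f.1 ≠ f.2) : twoTerm (K := K) e f s = 0 := by
  rw [not_not] at h
  unfold twoTerm
  split_ifs with h1 h2
  · exact absurd (by rw [h]) h2
  · rfl
  · rfl

theorem std_parallel {n : ℕ} (i j k l : Fin (n + 2)) (h : i ≠ j) (h' : k ≠ l)
    (h1 : ¬ std i j h k ≠ std i j h l) : ¬ std k l h' i ≠ std k l h' j := by
  rw [not_not] at h1 ⊢
  apply Fin.ext
  have e : (i : ℕ) ≠ j := fun e => h (Fin.ext e)
  have e' : (k : ℕ) ≠ l := fun e => h' (Fin.ext e)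
  have e1 : (std i j h k : ℕ) = std i j h l := congrArg Fin.val h1
  have a1 := std_spec _ _ h k
  have a2 := std_spec _ _ h l
  have a4 := std_spec _ _ h' i
  have a5 := std_spec _ _ h' j
  omega

theorem twoTerm_antisymm {n : ℕ} (e f : Fin (n + 2) × Fin (n + 2)) (s : OrientedGraph (n + 2)) :
    twoTerm (K := K) e f s + twoTerm f e s = 0 := by
  by_cases he : e.1 ≠ e.2
  swap
  · rw [twoTerm_zero_of_loop f e s he, twoTerm, dif_neg he, add_zero]
  by_cases hf : f.1 ≠ f.2
  swap
  · rw [twoTerm_zero_of_loop e f s hf, twoTerm, dif_neg hf, add_zero]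
  rw [twoTerm, twoTerm, dif_pos he, dif_pos hf]
  by_cases h1 : std e.1 e.2 he f.1 ≠ std e.1 e.2 he f.2
  · have h2 : std f.1 f.2 hf e.1 ≠ std f.1 f.2 hf e.2 := by
      by_contra h2
      exact std_parallel _ _ _ _ hf he (not_not.mpr h2) h1
    rw [dif_pos h1, dif_pos h2]
    have hm : (s.map (stdEdge e.1 e.2 he)).map (stdEdge _ _ h1) =
        (s.map (stdEdge f.1 f.2 hf)).map (stdEdge _ _ h2) := by
      rw [Multiset.map_map, Multiset.map_map]
      apply Multiset.map_congr rfl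
      intro x _
      exact Prod.ext (std_std _ _ _ _ he hf h1 h2 x.1) (std_std _ _ _ _ he hf h1 h2 x.2)
    rw [hm, ← add_smul, ← Int.cast_add]
    have hc := edgeCoeff_stdEdge e.1 e.2 f.1 f.2 he hf h1 h2
    have hc' : edgeCoeff e * edgeCoeff (stdEdge e.1 e.2 he f) +
        edgeCoeff f * edgeCoeff (stdEdge f.1 f.2 hf e) = 0 := by
      rw [← neg_eq_iff_add_eq_zero, eq_comm, ← neg_eq_iff_eq_neg]
      rw [eq_comm, eq_comm] at hc
      linarith [hc, show edgeCoeff e * edgeCoeff (stdEdge e.1 e.2 he f) =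
        edgeCoeff (e.1, e.2) * edgeCoeff (std e.1 e.2 he f.1, std e.1 e.2 he f.2) from rfl,
        show edgeCoeff f * edgeCoeff (stdEdge f.1 f.2 hf e) =
        edgeCoeff (f.1, f.2) * edgeCoeff (std f.1 f.2 hf e.1, std f.1 f.2 hf e.2) from rfl]
    rw [hc', Int.cast_zero, zero_smul]
  · rw [dif_neg h1, dif_neg (std_parallel _ _ _ _ he hf h1), add_zero]

theorem delta_edgeTerm {n : ℕ} (G : OrientedGraph (n + 2)) (e : Fin (n + 2) × Fin (n + 2)) :
    delta K n (edgeTerm K G e) =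
      ((G.erase e).map fun f => twoTerm e f ((G.erase e).erase f + 0)).sum := by
  by_cases he : e.1 ≠ e.2
  · rw [edgeTerm, dif_pos he, map_smul, delta_graphClass]
    unfold deltaGraph contract
    rw [Multiset.map_map, Multiset.smul_sum, Multiset.map_map]
    apply congrArg Multiset.sum
    apply Multiset.map_congr rfl
    intro f hf
    simp only [Function.comp_apply, edgeTerm, twoTerm, dif_pos he, add_zero]
    by_cases h1 : std e.1 e.2 he f.1 ≠ std e.1 e.2 he f.2
    · rw [dif_pos h1, dif_pos (show (stdEdge e.1 e.2 he f).1 ≠ (stdEdge e.1 e.2 he f).2 from h1)]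
      unfold contract
      rw [← Multiset.map_erase_of_mem _ _ hf, smul_smul, Int.cast_mul]
      rfl
    · rw [dif_neg h1, dif_neg (show ¬ (stdEdge e.1 e.2 he f).1 ≠ (stdEdge e.1 e.2 he f).2 from h1),
        smul_zero]
  · rw [edgeTerm, dif_neg he, map_zero]
    symm
    apply Multiset.sum_eq_zero
    intro x hx
    obtain ⟨f, -, rfl⟩ := Multiset.mem_map.mp hx
    rw [twoTerm, dif_neg he]

theorem delta_delta (n : ℕ) : delta K n ∘ₗ delta K (n + 1) = 0 := by
  apply graphSpace_ext
  intro G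
  rw [LinearMap.comp_apply, delta_graphClass, deltaGraph, map_multiset_sum, Multiset.map_map,
    LinearMap.zero_apply]
  rw [← sum_sum_erase_eq_zero twoTerm twoTerm_antisymm G 0]
  exact congrArg Multiset.sum (Multiset.map_congr rfl fun e _ => delta_edgeTerm G e)

variable (K)

/-- The complex of symmetric graphs, graded by the number of vertices. -/
def graphComplex : ChainComplex (ModuleCat.{u} K) ℕ :=
  ChainComplex.of (fun n => ModuleCat.of K (GraphSpace K n)) (fun n => ModuleCat.ofHom (delta K n))
    (fun n => by
      rw [← ModuleCat.ofHom_comp, delta_delta]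
      rfl)

end Chains

/-- The valency of the vertex `v`: the number of edges of `G` with `v` as an end. -/
def valency {n : ℕ} (G : OrientedGraph n) (v : Fin n) : ℕ :=
  G.countP fun e => e.1 = v ∨ e.2 = v

/-- `G` is connected: the underlying simple graph on the vertices of `G` is connected (in particular
`G` has a vertex). -/
def IsConnected {n : ℕ} (G : OrientedGraph n) : Prop :=
  (SimpleGraph.fromRel fun v w => (v, w) ∈ G).Connected

/-- A polygon: a connected graph without loops all of whose vertices are bivalent. -/
structure IsPolygon {n : ℕ} (G : OrientedGraph n) : Prop where
  loopless : ∀ e ∈ G, e.1 ≠ e.2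
  connected : IsConnected G
  bivalent : ∀ v, valency G v = 2

theorem std_eq_iff {n : ℕ} (i j : Fin (n + 1)) (h : i ≠ j) (k l : Fin (n + 1)) :
    std i j h k = std i j h l ↔ k = l ∨ (k = i ∧ l = j) ∨ (k = j ∧ l = i) := by
  have a1 := std_spec i j h k
  have a2 := std_spec i j h l
  have e : (i : ℕ) ≠ j := fun e => h (Fin.ext e)
  simp only [Fin.ext_iff]
  omega

theorem std_surjective {n : ℕ} (i j : Fin (n + 1)) (h : i ≠ j) :
    Function.Surjective (std i j h) := by
  intro y
  by_cases hy : (y : ℕ) < max (i : ℕ) j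
  · refine ⟨⟨y, by omega⟩, Fin.ext ?_⟩
    have := std_spec i j h ⟨y, by omega⟩
    simp only at this
    omega
  · refine ⟨⟨y + 1, by omega⟩, Fin.ext ?_⟩
    have := std_spec i j h ⟨y + 1, by omega⟩
    simp only at this
    omega

theorem IsConnected.contract {n : ℕ} {G : OrientedGraph (n + 1)} (hG : IsConnected G)
    (e : Fin (n + 1) × Fin (n + 1)) (h : e.1 ≠ e.2) : IsConnected (contract G e h) := by
  have step : ∀ v w, (v, w) ∈ G → (SimpleGraph.fromRel fun v w =>
      (v, w) ∈ SymGraph.contract G e h).Reachable (std e.1 e.2 h v) (std e.1 e.2 h w) := by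
    intro v w hvw
    by_cases heq : std e.1 e.2 h v = std e.1 e.2 h w
    · rw [heq]
    · apply SimpleGraph.Adj.reachable
      rw [SimpleGraph.fromRel_adj]
      refine ⟨heq, Or.inl ?_⟩
      have hne : (v, w) ≠ e := by
        rintro rfl
        exact heq ((std_eq_iff _ _ _ _ _).mpr (Or.inr (Or.inl ⟨rfl, rfl⟩)))
      exact Multiset.mem_map.mpr ⟨(v, w), (Multiset.mem_erase_of_ne hne).mpr hvw, rfl⟩
  have reach : ∀ v w, (SimpleGraph.fromRel fun v w => (v, w) ∈ G).Reachable v w →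
      (SimpleGraph.fromRel fun v w => (v, w) ∈ SymGraph.contract G e h).Reachable
        (std e.1 e.2 h v) (std e.1 e.2 h w) := by
    rintro v w ⟨p⟩
    induction p with
    | nil => exact SimpleGraph.Reachable.refl _
    | cons hadj _ ih =>
      refine SimpleGraph.Reachable.trans ?_ ih
      rw [SimpleGraph.fromRel_adj] at hadj
      rcases hadj.2 with h' | h'
      · exact step _ _ h'
      · exact (step _ _ h').symm
  have : Nonempty (Fin n) := ⟨std e.1 e.2 h e.1⟩
  unfold IsConnected
  rw [SimpleGraph.connected_iff]
  refine ⟨fun x y => ?_, this⟩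
  obtain ⟨v, rfl⟩ := std_surjective e.1 e.2 h x
  obtain ⟨w, rfl⟩ := std_surjective e.1 e.2 h y
  exact reach v w (hG.preconnected v w)

theorem IsPolygon.contract {n : ℕ} {G : OrientedGraph (n + 1)} (hG : IsPolygon G)
    (e : Fin (n + 1) × Fin (n + 1)) (he : e ∈ G) (h : e.1 ≠ e.2)
    (hl : ∀ f ∈ contract G e h, f.1 ≠ f.2) : IsPolygon (contract G e h) := by
  refine ⟨hl, hG.connected.contract e h, fun x => ?_⟩
  obtain ⟨s, rfl⟩ := Multiset.exists_cons_of_mem he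
  have hval : ∀ v, (if e.1 = v ∨ e.2 = v then 1 else 0) + valency s v = 2 := by
    intro v
    rw [← hG.bivalent v, valency, valency, Multiset.countP_cons, add_comm]
  have hl' : ∀ f ∈ s, std e.1 e.2 h f.1 ≠ std e.1 e.2 h f.2 := by
    intro f hf
    refine hl (stdEdge e.1 e.2 h f) (Multiset.mem_map.mpr ⟨f, ?_, rfl⟩)
    rwa [Multiset.erase_cons_head]
  have hc : SymGraph.contract (e ::ₘ s) e h = s.map (stdEdge e.1 e.2 h) := by
    unfold SymGraph.contract
    rw [Multiset.erase_cons_head]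
  rw [hc, valency, Multiset.countP_map, ← Multiset.countP_eq_card_filter]
  obtain ⟨v, rfl⟩ := std_surjective e.1 e.2 h x
  by_cases hv : e.1 = v ∨ e.2 = v
  · have h1 := hval e.1
    have h2 := hval e.2
    rw [if_pos (Or.inl rfl)] at h1
    rw [if_pos (Or.inr rfl)] at h2
    have key : ∀ t : OrientedGraph (n + 1),
        (∀ f ∈ t, std e.1 e.2 h f.1 ≠ std e.1 e.2 h f.2) →
        t.countP (fun f => (stdEdge e.1 e.2 h f).1 = std e.1 e.2 h v ∨
          (stdEdge e.1 e.2 h f).2 = std e.1 e.2 h v) = valency t e.1 + valency t e.2 := by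
      intro t
      induction t using Multiset.induction_on with
      | empty => intro _; simp [valency]
      | cons f t ih =>
        intro ht
        have ht1 := ht f (Multiset.mem_cons_self f t)
        have ht2 := ih fun g hg => ht g (Multiset.mem_cons_of_mem hg)
        unfold valency at ht2 ⊢
        rw [Multiset.countP_cons, Multiset.countP_cons, Multiset.countP_cons, ht2]
        simp only [stdEdge, ne_eq, std_eq_iff] at ht1 ⊢
        grind
    rw [key s hl']
    omega
  · have h1 := hval v
    rw [if_neg hv, zero_add] at h1
    rw [← h1, valency]
    apply Multiset.countP_congr rfl
    intro f _
    simp only [stdEdge, std_eq_iff]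
    grind

noncomputable section Polygons

variable (K : Type u) [Field K]

/-- The subspace `K[P]` of the chain module of graphs with `n` vertices that is spanned by the
polygons. -/
def polygonSpace (n : ℕ) : Submodule K (GraphSpace K n) :=
  Submodule.span K {x | ∃ G : OrientedGraph n, IsPolygon G ∧ x = graphClass K G}

theorem delta_mem_polygonSpace [CharZero K] {n : ℕ} (x : GraphSpace K (n + 1))
    (hx : x ∈ polygonSpace K (n + 1)) : delta K n x ∈ polygonSpace K n := by
  have hle : polygonSpace K (n + 1) ≤ (polygonSpace K n).comap (delta K n) := by
    rw [polygonSpace, Submodule.span_le]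
    rintro _ ⟨G, hG, rfl⟩
    change delta K n (graphClass K G) ∈ polygonSpace K n
    rw [delta_graphClass]
    apply multiset_sum_mem
    intro y hy
    obtain ⟨e, he, rfl⟩ := Multiset.mem_map.mp hy
    have h := hG.loopless e he
    rw [edgeTerm, dif_pos h]
    apply Submodule.smul_mem
    by_cases hl : ∀ f ∈ contract G e h, f.1 ≠ f.2
    · exact Submodule.subset_span ⟨_, hG.contract e he h hl, rfl⟩
    · push Not at hl
      obtain ⟨f, hf, hff⟩ := hl
      rw [graphClass_eq_zero _ f hf hff]
      exact Submodule.zero_mem _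
  exact hle hx

/-- The subcomplex `K[P]` of the complex of symmetric graphs that is spanned by the polygons; it is
graded by the number of vertices, and its differential is the restriction of `δ`. -/
def polygonComplex [CharZero K] : ChainComplex (ModuleCat.{u} K) ℕ :=
  ChainComplex.of (fun n => ModuleCat.of K (polygonSpace K n))
    (fun n => ModuleCat.ofHom ((delta K n).restrict (delta_mem_polygonSpace K)))
    (fun n => by
      rw [← ModuleCat.ofHom_comp]
      apply ModuleCat.hom_ext
      apply LinearMap.ext
      intro x
      exact Subtype.ext (LinearMap.congr_fun (delta_delta n) x.1))

end Polygons

end SymGraph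

/-!
The polygons with `n` vertices are the cyclic arrangements of `1, …, n` up to reflection with a sign,
and the acyclicity of `K[P]` comes from an explicit contracting homotopy. Let `H` send a graph to the
sum, over its edges `[1, x]` at the first vertex, of the graphs in which this edge is subdivided by a
new vertex labelled `2`, the labels `2, 3, …` of the other vertices being raised by one. On the
polygons

  `δ H + H δ = 2`,

so a cycle `z` is the boundary of `H z / 2`. Up to a sign, a polygon is `G = [1, x] + [1, y] + s` with
no edge of `s` at `1` (`IsPolygon.exists_normalForm`), and `H G` is the sum of its subdivisions on
`[1, x]` and on `[1, y]`. The terms of `δ H G` are of four types.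

* Contracting the new edge `[1, 2]` gives back `G`, with sign `+1`, and this happens twice
  (`edgeTerm_subdivide_zero_one`).
* Contracting an edge `f` of `s` commutes with the subdivision. As the larger end of `f` has been
  raised by one, the sign changes, so these terms cancel the terms of `H δ G` in which `f` is
  contracted (`edgeTerm_subdivide_add`).
* Suppose that `[1, x]` has been subdivided and the half `[2, x]` is contracted. Let `[x, z]` be the
  other edge at the bivalent vertex `x`. Then `2` becomes the neighbour of `1` on the way to `z`, so
  the result is the subdivision of the edge `[1, z]` of `G / [1, x]`.
* Suppose that `[1, y]` has been subdivided and `[1, x]` is contracted. The result is the subdivision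
  of `[1, y]` in `G / [1, x]`.

The last two types, together with the same terms for `x` and `y` exchanged, cancel the terms of
`H δ G` in which `[1, x]` or `[1, y]` is contracted (`edgeTerm_subdivide_at_zero`). When `x = y`, which
happens for the polygon with two vertices, the two contributions cancel each other. For `n ≤ 1` there
are no polygons.
-/

open CategoryTheory

namespace SymGraph

universe u

/-! ### Subdividing an edge at the first vertex -/

/-- The order embedding `{1, …, n} → {1, …, n + 1}` that misses the second vertex. -/
def shift {n : ℕ} (k : Fin (n + 1)) : Fin (n + 2) := (1 : Fin (n + 2)).succAbove k

/-- The action of `shift` on oriented edges. -/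
def shiftEdge {n : ℕ} (e : Fin (n + 1) × Fin (n + 1)) : Fin (n + 2) × Fin (n + 2) :=
  (shift e.1, shift e.2)

theorem shift_zero {n : ℕ} : shift (0 : Fin (n + 1)) = 0 := by
  simp [shift]

theorem shift_spec {n : ℕ} (k : Fin (n + 1)) :
    ((k : ℕ) = 0 ∧ (shift k : ℕ) = 0) ∨ (0 < (k : ℕ) ∧ (shift k : ℕ) = k + 1) := by
  rcases Nat.eq_zero_or_pos (k : ℕ) with h | h
  · left
    have : k = 0 := Fin.ext h
    subst this
    simp [shift_zero]
  · right
    refine ⟨h, ?_⟩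
    rw [shift, Fin.succAbove_of_le_castSucc _ _ (by
      rw [Fin.le_def, Fin.val_one]
      exact h)]
    simp

theorem shift_injective {n : ℕ} : Function.Injective (shift : Fin (n + 1) → Fin (n + 2)) :=
  Fin.succAbove_right_injective

theorem shift_ne_one {n : ℕ} (k : Fin (n + 1)) : shift k ≠ 1 := Fin.succAbove_ne _ _

theorem eq_one_or_exists_shift {n : ℕ} (k : Fin (n + 2)) : k = 1 ∨ ∃ l, k = shift l := by
  rcases Fin.eq_self_or_eq_succAbove 1 k with h | ⟨l, h⟩
  · exact Or.inl h
  · exact Or.inr ⟨l, h⟩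

/-- The graph obtained from `[1, x] + s` by subdividing the edge `[1, x]`: the new vertex gets
the label `2`, the labels `2, 3, …` being raised by one. -/
def subdivide {n : ℕ} (x : Fin (n + 1)) (s : OrientedGraph (n + 1)) : OrientedGraph (n + 2) :=
  (0, 1) ::ₘ (1, shift x) ::ₘ s.map shiftEdge

theorem subdivide_cons {n : ℕ} (x : Fin (n + 1)) (e : Fin (n + 1) × Fin (n + 1))
    (s : OrientedGraph (n + 1)) : subdivide x (e ::ₘ s) = shiftEdge e ::ₘ subdivide x s := by
  rw [subdivide, subdivide, Multiset.map_cons, Multiset.cons_swap (1, _),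
    Multiset.cons_swap (0, 1)]

noncomputable section Homotopy

variable {K : Type u} [Field K]

variable (K) in
/-- The class of the subdivision of `e` in `e + s` if `e` starts at the first vertex, else `0`. -/
def subdivideStart {n : ℕ} (e : Fin (n + 1) × Fin (n + 1)) (s : OrientedGraph (n + 1)) :
    GraphSpace K (n + 2) :=
  if e.1 = 0 then graphClass K (subdivide e.2 s) else 0

variable (K) in
/-- The contribution of the edge `e` of `e + s` to the homotopy. An edge ending at the first
vertex is reversed, whence the minus sign. -/
def subdivideTerm {n : ℕ} (e : Fin (n + 1) × Fin (n + 1)) (s : OrientedGraph (n + 1)) :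
    GraphSpace K (n + 2) :=
  subdivideStart K e s - subdivideStart K e.swap s

theorem subdivideTerm_swap {n : ℕ} (e : Fin (n + 1) × Fin (n + 1)) (s : OrientedGraph (n + 1)) :
    subdivideTerm K e.swap s = - subdivideTerm K e s := by
  rw [subdivideTerm, subdivideTerm, Prod.swap_swap, neg_sub]

theorem subdivideStart_cons_swap {n : ℕ} (e f : Fin (n + 1) × Fin (n + 1))
    (s : OrientedGraph (n + 1)) :
    subdivideStart K f (e.swap ::ₘ s) = - subdivideStart K f (e ::ₘ s) := by
  unfold subdivideStart
  split_ifs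
  · rw [subdivide_cons, subdivide_cons, show shiftEdge e.swap = (shiftEdge e).swap from rfl,
      graphClass_swap]
  · rw [neg_zero]

theorem subdivideTerm_cons_swap {n : ℕ} (e f : Fin (n + 1) × Fin (n + 1))
    (s : OrientedGraph (n + 1)) :
    subdivideTerm K f (e.swap ::ₘ s) = - subdivideTerm K f (e ::ₘ s) := by
  rw [subdivideTerm, subdivideTerm, subdivideStart_cons_swap, subdivideStart_cons_swap, neg_sub,
    neg_sub_neg]

variable (K) in
/-- The sum over the edges of `G` at the first vertex of the subdivisions of that edge. -/
def homotopyGraph {n : ℕ} (G : OrientedGraph (n + 1)) : GraphSpace K (n + 2) :=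
  (G.map fun e => subdivideTerm K e (G.erase e)).sum

theorem homotopyGraph_cons {n : ℕ} (e : Fin (n + 1) × Fin (n + 1)) (s : OrientedGraph (n + 1)) :
    homotopyGraph K (e ::ₘ s) =
      subdivideTerm K e s + (s.map fun f => subdivideTerm K f (e ::ₘ s.erase f)).sum := by
  unfold homotopyGraph
  rw [Multiset.map_cons, Multiset.sum_cons, Multiset.erase_cons_head]
  congr 2
  apply Multiset.map_congr rfl
  intro f hf
  rw [Multiset.erase_cons_tail_of_mem hf]

theorem homotopyGraph_swap {n : ℕ} (e : Fin (n + 1) × Fin (n + 1)) (s : OrientedGraph (n + 1)) :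
    homotopyGraph K (e.swap ::ₘ s) = - homotopyGraph K (e ::ₘ s) := by
  rw [homotopyGraph_cons, homotopyGraph_cons, subdivideTerm_swap, neg_add]
  simp only [subdivideTerm_cons_swap, Multiset.sum_map_neg]

variable (K) in
/-- The homotopy from graphs with `n + 1` vertices to graphs with `n + 2` vertices. -/
def homotopy (n : ℕ) : GraphSpace K (n + 1) →ₗ[K] GraphSpace K (n + 2) :=
  (orientationRel K (n + 1)).liftQ (Finsupp.linearCombination K (homotopyGraph K)) (by
    unfold orientationRel
    rw [Submodule.span_le]
    rintro x ⟨e, s, rfl⟩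
    change Finsupp.linearCombination K (homotopyGraph K) _ = 0
    rw [map_add, Finsupp.linearCombination_single,
      Finsupp.linearCombination_single, homotopyGraph_swap, one_smul, one_smul, add_neg_cancel])

theorem homotopy_graphClass {n : ℕ} (G : OrientedGraph (n + 1)) :
    homotopy K n (graphClass K G) = homotopyGraph K G := by
  unfold homotopy graphClass
  rw [Submodule.mkQ_apply, Submodule.liftQ_apply]
  simp

/-- The value of the homotopy on a graph with exactly two edges at the first vertex. -/
theorem homotopyGraph_cons_cons {n : ℕ} {x y : Fin (n + 1)} (hx : x ≠ 0) (hy : y ≠ 0)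
    {s : OrientedGraph (n + 1)} (hs : ∀ f ∈ s, f.1 ≠ 0 ∧ f.2 ≠ 0) :
    homotopyGraph K ((0, x) ::ₘ (0, y) ::ₘ s) =
      graphClass K (subdivide x ((0, y) ::ₘ s)) + graphClass K (subdivide y ((0, x) ::ₘ s)) := by
  have hz : (s.map fun f =>
      subdivideTerm K f ((0, x) ::ₘ ((0, y) ::ₘ s).erase f)).sum = 0 := by
    apply Multiset.sum_eq_zero
    intro z hz
    obtain ⟨f, hf, rfl⟩ := Multiset.mem_map.mp hz
    simp [subdivideTerm, subdivideStart, hs f hf]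
  rw [homotopyGraph_cons, Multiset.map_cons, Multiset.sum_cons, hz, Multiset.erase_cons_head,
    add_zero]
  simp [subdivideTerm, subdivideStart, hx, hy]

/-! ### Contracting an edge of a subdivided graph -/

theorem std_zero {n : ℕ} (i j : Fin (n + 2)) (h : i ≠ j) : std i j h 0 = 0 := by
  have := std_spec i j h 0
  have e : (i : ℕ) ≠ j := fun e => h (Fin.ext e)
  apply Fin.ext
  simp only [Fin.val_zero] at this ⊢
  omega

theorem std_eq_zero_iff {n : ℕ} (i j : Fin (n + 2)) (h : i ≠ j) (k : Fin (n + 2)) :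
    std i j h k = 0 ↔ k = 0 ∨ (k = i ∧ j = 0) ∨ (k = j ∧ i = 0) := by
  rw [← std_zero i j h, std_eq_iff]
  tauto

theorem std_zero_one_shift {n : ℕ} (h : (0 : Fin (n + 2)) ≠ 1) (k : Fin (n + 1)) :
    std 0 1 h (shift k) = k := by
  have a := std_spec 0 1 h (shift k)
  have b := shift_spec k
  simp only [Fin.val_zero, Fin.val_one] at a
  apply Fin.ext
  omega

theorem shift_ne_shift {n : ℕ} {i j : Fin (n + 1)} (h : i ≠ j) : shift i ≠ shift j :=
  fun e => h (shift_injective e)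

/-- Contraction of an old edge commutes with the raising of the labels. -/
theorem std_shift_shift {n : ℕ} (i j : Fin (n + 2)) (h : i ≠ j) (k : Fin (n + 2)) :
    std (shift i) (shift j) (shift_ne_shift h) (shift k) = shift (std i j h k) := by
  have a := std_spec (shift i) (shift j) (shift_ne_shift h) (shift k)
  have b := std_spec i j h k
  have c := shift_spec i
  have d := shift_spec j
  have e := shift_spec k
  have f := shift_spec (std i j h k)
  have e : (i : ℕ) ≠ j := fun e => h (Fin.ext e)
  apply Fin.ext
  omega

theorem std_shift_one {n : ℕ} (i j : Fin (n + 2)) (h : i ≠ j) :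
    std (shift i) (shift j) (shift_ne_shift h) 1 = 1 := by
  have a := std_spec (shift i) (shift j) (shift_ne_shift h) 1
  have c := shift_spec i
  have d := shift_spec j
  have e : (i : ℕ) ≠ j := fun e => h (Fin.ext e)
  apply Fin.ext
  simp only [Fin.val_one] at a ⊢
  omega

/-- Away from the ends of the contracted edge, contracting the second half of the subdivided edge
has the effect of contracting the edge and then raising the labels. -/
theorem std_one_shift {n : ℕ} {x : Fin (n + 2)} (h : (0 : Fin (n + 2)) ≠ x) {k : Fin (n + 2)}
    (hk : k ≠ x) : std 1 (shift x) (shift_ne_one x).symm (shift k) = shift (std 0 x h k) := by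
  have a := std_spec 1 (shift x) (shift_ne_one x).symm (shift k)
  have b := std_spec 0 x h k
  have c := shift_spec x
  have d := shift_spec k
  have f := shift_spec (std 0 x h k)
  have e : (0 : ℕ) ≠ x := fun e => h (Fin.ext e)
  have e' : (k : ℕ) ≠ x := fun e => hk (Fin.ext e)
  apply Fin.ext
  simp only [Fin.val_zero, Fin.val_one] at a b ⊢
  omega

theorem std_one_shift_one {n : ℕ} {x : Fin (n + 2)} (h : (0 : Fin (n + 2)) ≠ x) :
    std 1 (shift x) (shift_ne_one x).symm 1 = 1 := by
  have a := std_spec 1 (shift x) (shift_ne_one x).symm 1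
  have c := shift_spec x
  have e : (0 : ℕ) ≠ x := fun e => h (Fin.ext e)
  apply Fin.ext
  simp only [Fin.val_one] at a ⊢
  omega

theorem std_right {n : ℕ} (i j : Fin (n + 1)) (h : i ≠ j) : std i j h j = std i j h i :=
  (std_eq_iff _ _ _ _ _).mpr (Or.inr (Or.inr ⟨rfl, rfl⟩))

theorem edgeCoeff_shiftEdge {n : ℕ} {e : Fin (n + 1) × Fin (n + 1)} (h : e.1 ≠ e.2) :
    edgeCoeff (shiftEdge e) = - edgeCoeff e := by
  have c := shift_spec e.1
  have d := shift_spec e.2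
  have e0 : (e.1 : ℕ) ≠ e.2 := fun e => h (Fin.ext e)
  have hm : max (shift e.1 : ℕ) (shift e.2) = max (e.1 : ℕ) e.2 + 1 := by omega
  have hs : shift e.2 < shift e.1 ↔ e.2 < e.1 := by
    rw [Fin.lt_def, Fin.lt_def]; omega
  simp only [edgeCoeff, edgeSign, shiftEdge, hm, hs, pow_succ]
  ring

theorem edgeCoeff_zero_one {n : ℕ} : edgeCoeff ((0, 1) : Fin (n + 2) × Fin (n + 2)) = 1 := by
  simp [edgeCoeff, edgeSign]

theorem edgeCoeff_one_shift {n : ℕ} {x : Fin (n + 1)} (hx : x ≠ 0) :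
    edgeCoeff (1, shift x) = - edgeCoeff (0, x) := by
  have c := shift_spec x
  have e0 : (x : ℕ) ≠ 0 := fun e => hx (Fin.ext e)
  have hm : max (1 : ℕ) (shift x) = x + 1 := by omega
  have hs : ¬ shift x < 1 := by
    rw [Fin.lt_def, Fin.val_one]; omega
  simp [edgeCoeff, edgeSign, hm, hs, pow_succ]

theorem edgeTerm_cons_self {n : ℕ} {e : Fin (n + 1) × Fin (n + 1)} (h : e.1 ≠ e.2)
    (s : OrientedGraph (n + 1)) : edgeTerm K (e ::ₘ s) e =
      (edgeCoeff e : K) • graphClass K (s.map (stdEdge e.1 e.2 h)) := by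
  rw [edgeTerm, dif_pos h, contract, Multiset.erase_cons_head]

/-- Contracting the first half of the subdivided edge gives back the original graph. -/
theorem edgeTerm_subdivide_zero_one {n : ℕ} (x : Fin (n + 1)) (s : OrientedGraph (n + 1)) :
    edgeTerm K (subdivide x s) (0, 1) = graphClass K ((0, x) ::ₘ s) := by
  have h : (0 : Fin (n + 2)) ≠ 1 := by simp
  rw [subdivide, edgeTerm_cons_self (e := (0, 1)) h, edgeCoeff_zero_one, Int.cast_one, one_smul,
    Multiset.map_cons, Multiset.map_map]
  congr 2
  · exact Prod.ext ((std_right _ _ h).trans (by simpa [shift_zero] using std_zero_one_shift h 0))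
      (std_zero_one_shift h x)
  · conv_rhs => rw [← Multiset.map_id s]
    apply Multiset.map_congr rfl
    intro f _
    exact Prod.ext (std_zero_one_shift h f.1) (std_zero_one_shift h f.2)

/-- Contracting an old edge commutes with the subdivision up to sign: the larger end of the edge is
raised by one. -/
theorem edgeTerm_subdivide_shiftEdge {n : ℕ} (x : Fin (n + 2)) {f : Fin (n + 2) × Fin (n + 2)}
    (h : f.1 ≠ f.2) (s : OrientedGraph (n + 2)) :
    edgeTerm K (subdivide x (f ::ₘ s)) (shiftEdge f) = - (edgeCoeff f : K) •
      graphClass K (subdivide (std f.1 f.2 h x) (s.map (stdEdge f.1 f.2 h))) := by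
  rw [subdivide_cons, edgeTerm_cons_self (e := shiftEdge f) (shift_ne_shift h),
    edgeCoeff_shiftEdge h, Int.cast_neg]
  congr 2
  rw [subdivide, subdivide, Multiset.map_cons, Multiset.map_cons, Multiset.map_map,
    Multiset.map_map]
  congr 1
  · exact Prod.ext (std_zero _ _ (shift_ne_shift h)) (std_shift_one _ _ h)
  congr 1
  · exact Prod.ext (std_shift_one _ _ h) (std_shift_shift _ _ h x)
  · apply Multiset.map_congr rfl
    intro g _
    exact Prod.ext (std_shift_shift _ _ h g.1) (std_shift_shift _ _ h g.2)

theorem edgeTerm_subdivide_zero_shift {n : ℕ} {x : Fin (n + 2)} (hx : 0 ≠ x) (y : Fin (n + 2))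
    (s : OrientedGraph (n + 2)) :
    edgeTerm K (subdivide y ((0, x) ::ₘ s)) (0, shift x) = - (edgeCoeff (0, x) : K) •
      graphClass K (subdivide (std 0 x hx y) (s.map (stdEdge 0 x hx))) := by
  rw [← edgeTerm_subdivide_shiftEdge y (f := (0, x)) hx, shiftEdge, shift_zero]

theorem edgeTerm_subdivide_one_shift {n : ℕ} {x : Fin (n + 2)} (hx : x ≠ 0)
    (s : OrientedGraph (n + 2)) :
    edgeTerm K (subdivide x s) (1, shift x) = - (edgeCoeff (0, x) : K) •
      graphClass K ((0, 1) ::ₘ (s.map shiftEdge).map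
        (stdEdge 1 (shift x) (shift_ne_one x).symm)) := by
  rw [subdivide, Multiset.cons_swap, edgeTerm_cons_self (e := (1, shift x)) (shift_ne_one x).symm,
    edgeCoeff_one_shift hx, Int.cast_neg, Multiset.map_cons]
  congr 3
  exact Prod.ext (std_zero _ _ (shift_ne_one x).symm) (std_one_shift_one hx.symm)

theorem map_stdEdge_one_shift {n : ℕ} {x : Fin (n + 2)} (hx : 0 ≠ x) {s : OrientedGraph (n + 2)}
    (hs : ∀ f ∈ s, f.1 ≠ x ∧ f.2 ≠ x) :
    (s.map shiftEdge).map (stdEdge 1 (shift x) (shift_ne_one x).symm) =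
      (s.map (stdEdge 0 x hx)).map shiftEdge := by
  rw [Multiset.map_map, Multiset.map_map]
  apply Multiset.map_congr rfl
  intro f hf
  exact Prod.ext (std_one_shift hx (hs f hf).1) (std_one_shift hx (hs f hf).2)

/-! ### The homotopy identity -/

/-- If `[1, x]` is a double edge, with one copy subdivided, then contracting the half `[2, x]` and
contracting the other copy give the same graph up to the orientation of one edge between `1` and
`2`; contracting `[1, x]` in the original graph gives a loop. -/
theorem edgeTerm_subdivide_at_zero_of_double {n : ℕ} {x : Fin (n + 2)} (hx : x ≠ 0)
    {s : OrientedGraph (n + 2)} (hs : ∀ f ∈ s, f.1 ≠ x ∧ f.2 ≠ x) [CharZero K] :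
    edgeTerm K (subdivide x ((0, x) ::ₘ s)) (1, shift x) +
      edgeTerm K (subdivide x ((0, x) ::ₘ s)) (0, shift x) =
    - homotopy K n (edgeTerm K ((0, x) ::ₘ (0, x) ::ₘ s) (0, x)) := by
  have hx' : std 0 x hx.symm x = 0 := (std_right _ _ _).trans (std_zero _ _ _)
  rw [edgeTerm_cons_self (e := (0, x)) hx.symm, Multiset.map_cons,
    graphClass_eq_zero _ _ (Multiset.mem_cons_self _ _)
      (show std 0 x hx.symm 0 = std 0 x hx.symm x from (std_right _ _ _).symm), smul_zero,
    map_zero, neg_zero, edgeTerm_subdivide_one_shift hx,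
    edgeTerm_subdivide_zero_shift hx.symm, ← smul_add, subdivide, Multiset.map_cons,
    Multiset.map_cons, map_stdEdge_one_shift hx.symm hs, hx', shift_zero]
  have h : stdEdge 1 (shift x) (shift_ne_one x).symm (shiftEdge (0, x)) =
      Prod.swap (1, 0) :=
    Prod.ext ((congrArg (std 1 (shift x) (shift_ne_one x).symm) shift_zero).trans
      (std_zero _ _ _)) ((std_right _ _ (shift_ne_one x).symm).trans (std_one_shift_one hx.symm))
  rw [h, Multiset.cons_swap, graphClass_swap, Multiset.cons_swap, neg_add_cancel, smul_zero]

/-- Let `[x, z]` be the only edge at `x` besides `[1, x]`. Contracting `[2, x]` after `[1, x]` has been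
subdivided, and contracting `[1, x]` after `[1, y]` has been subdivided, give up to sign the
subdivisions of `[1, z]` and of `[1, y]` in the contraction of `[1, x]`. -/
theorem edgeTerm_subdivide_at_zero_of_edge {n : ℕ} {x y z : Fin (n + 2)} (hx : x ≠ 0) (hy : y ≠ 0)
    (hz : z ≠ 0) (hxy : y ≠ x) (hxz : z ≠ x) {s : OrientedGraph (n + 2)}
    (hs0 : ∀ f ∈ s, f.1 ≠ 0 ∧ f.2 ≠ 0) (hs : ∀ f ∈ s, f.1 ≠ x ∧ f.2 ≠ x) :
    edgeTerm K (subdivide x ((0, y) ::ₘ (x, z) ::ₘ s)) (1, shift x) +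
      edgeTerm K (subdivide y ((0, x) ::ₘ (x, z) ::ₘ s)) (0, shift x) =
    - homotopy K n (edgeTerm K ((0, x) ::ₘ (0, y) ::ₘ (x, z) ::ₘ s) (0, x)) := by
  have hx' : std 0 x hx.symm x = 0 := (std_right _ _ _).trans (std_zero _ _ _)
  have h0 : std 0 x hx.symm 0 = 0 := std_zero _ _ _
  have hne : ∀ k, k ≠ 0 → k ≠ x → std 0 x hx.symm k ≠ 0 := by
    intro k hk0 hkx h
    rw [std_eq_zero_iff] at h
    tauto
  have e1 : stdEdge 0 x hx.symm (0, y) = (0, std 0 x hx.symm y) := Prod.ext h0 rfl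
  have e2 : stdEdge 0 x hx.symm (x, z) = (0, std 0 x hx.symm z) := Prod.ext hx' rfl
  have e3 : stdEdge 1 (shift x) (shift_ne_one x).symm (shiftEdge (0, y)) =
      shiftEdge (0, std 0 x hx.symm y) :=
    Prod.ext ((std_one_shift hx.symm hx.symm).trans (congrArg _ h0)) (std_one_shift hx.symm hxy)
  have e4 : stdEdge 1 (shift x) (shift_ne_one x).symm (shiftEdge (x, z)) =
      (1, shift (std 0 x hx.symm z)) :=
    Prod.ext ((std_right _ _ _).trans (std_one_shift_one hx.symm)) (std_one_shift hx.symm hxz)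
  -- Here `[1, x]` and `[2, x]` have been merged: the new vertex `2` now lies between `1` and `z`.
  have e5 : (0, 1) ::ₘ shiftEdge (0, std 0 x hx.symm y) ::ₘ (1, shift (std 0 x hx.symm z)) ::ₘ
      (s.map (stdEdge 0 x hx.symm)).map shiftEdge =
      subdivide (std 0 x hx.symm z) ((0, std 0 x hx.symm y) ::ₘ s.map (stdEdge 0 x hx.symm)) := by
    rw [subdivide, Multiset.map_cons, Multiset.cons_swap (1, _)]
  rw [edgeTerm_cons_self (e := (0, x)) hx.symm, Multiset.map_cons, Multiset.map_cons, e1, e2,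
    map_smul, homotopy_graphClass, homotopyGraph_cons_cons (hne y hy hxy) (hne z hz hxz),
    edgeTerm_subdivide_one_shift hx, edgeTerm_subdivide_zero_shift hx.symm,
    Multiset.map_cons _ (x, z), e2, Multiset.map_cons, Multiset.map_cons, Multiset.map_cons,
    Multiset.map_cons, e3, e4,
    map_stdEdge_one_shift hx.symm hs, e5]
  · module
  · intro g hg
    obtain ⟨f, hf, rfl⟩ := Multiset.mem_map.mp hg
    exact ⟨hne _ (hs0 f hf).1 (hs f hf).1, hne _ (hs0 f hf).2 (hs f hf).2⟩

theorem exists_cons_of_countP_eq_succ {α : Type*} (p : α → Prop) [DecidablePred p]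
    {s : Multiset α} {k : ℕ} (h : s.countP p = k + 1) :
    ∃ a t, p a ∧ s = a ::ₘ t ∧ t.countP p = k := by
  obtain ⟨a, ha, hp⟩ := Multiset.countP_pos.mp (h.symm ▸ Nat.succ_pos k : 0 < s.countP p)
  obtain ⟨t, rfl⟩ := Multiset.exists_cons_of_mem ha
  refine ⟨a, t, hp, rfl, ?_⟩
  rw [Multiset.countP_cons_of_pos _ hp] at h
  omega

theorem valency_eq_zero_iff {n : ℕ} {G : OrientedGraph n} {v : Fin n} :
    valency G v = 0 ↔ ∀ e ∈ G, e.1 ≠ v ∧ e.2 ≠ v := by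
  simp only [valency, Multiset.countP_eq_zero, not_or, ne_eq]

/-- The terms of the homotopy identity that come from contracting `[1, x]`, or the half `[2, x]` of its
subdivision, cancel, since the vertex `x` is bivalent. -/
theorem edgeTerm_subdivide_at_zero [CharZero K] {n : ℕ} {x y : Fin (n + 2)} (hx : x ≠ 0)
    (hy : y ≠ 0)
    {s : OrientedGraph (n + 2)} (hs0 : ∀ f ∈ s, f.1 ≠ 0 ∧ f.2 ≠ 0) (hl : ∀ f ∈ s, f.1 ≠ f.2)
    (hv : valency ((0, x) ::ₘ (0, y) ::ₘ s) x = 2) :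
    edgeTerm K (subdivide x ((0, y) ::ₘ s)) (1, shift x) +
      edgeTerm K (subdivide y ((0, x) ::ₘ s)) (0, shift x) =
    - homotopy K n (edgeTerm K ((0, x) ::ₘ (0, y) ::ₘ s) (0, x)) := by
  rw [valency, Multiset.countP_cons_of_pos _ (by simp)] at hv
  by_cases hxy : y = x
  · subst hxy
    rw [Multiset.countP_cons_of_pos _ (by simp)] at hv
    exact edgeTerm_subdivide_at_zero_of_double hx (valency_eq_zero_iff.mp (by rw [valency]; omega))
  · rw [Multiset.countP_cons_of_neg _ (by simp [hxy, hx.symm])] at hv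
    obtain ⟨f, t, hf, rfl, ht⟩ := exists_cons_of_countP_eq_succ (k := 0) _ (Nat.succ.inj hv)
    have ht' := valency_eq_zero_iff.mp ht
    have ht0 : ∀ f ∈ t, f.1 ≠ 0 ∧ f.2 ≠ 0 := fun g hg => hs0 g (Multiset.mem_cons_of_mem hg)
    have hf0 := hs0 f (Multiset.mem_cons_self _ _)
    have hfl := hl f (Multiset.mem_cons_self _ _)
    obtain ⟨a, b⟩ := f
    rcases hf with rfl | rfl
    · exact edgeTerm_subdivide_at_zero_of_edge (K := K) hx hy hf0.2 hxy hfl.symm ht0 ht'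
    -- The edge at `x` points to `x`: both sides change sign when it is reversed.
    · have h := edgeTerm_subdivide_at_zero_of_edge (K := K) hx hy hf0.1 hxy hfl ht0 ht'
      have hswap : ∀ (u v : Fin (n + 2)) (e : Fin (n + 3) × Fin (n + 3)),
          e ∈ subdivide u ((0, v) ::ₘ t) →
          edgeTerm K (subdivide u ((0, v) ::ₘ (a, b) ::ₘ t)) e =
            - edgeTerm K (subdivide u ((0, v) ::ₘ (b, a) ::ₘ t)) e := by
        intro u v e he
        rw [Multiset.cons_swap _ (a, b), Multiset.cons_swap _ (b, a),
          subdivide_cons _ (a, b), subdivide_cons _ (b, a)]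
        exact edgeTerm_cons_swap (K := K) (shiftEdge (b, a)) e _ he
      have hswap' : edgeTerm K ((0, b) ::ₘ (0, y) ::ₘ (a, b) ::ₘ t) (0, b) =
          - edgeTerm K ((0, b) ::ₘ (0, y) ::ₘ (b, a) ::ₘ t) (0, b) := by
        rw [Multiset.cons_swap _ (a, b), Multiset.cons_swap _ (b, a), Multiset.cons_swap _ (a, b),
          Multiset.cons_swap _ (b, a)]
        exact edgeTerm_cons_swap (K := K) (b, a) (0, b) _ (Multiset.mem_cons_self _ _)
      rw [hswap _ _ _ (by simp [subdivide]),
        hswap _ _ _ (by simp [subdivide, shiftEdge, shift_zero]),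
        hswap', map_neg, ← neg_add, h]

/-- The differential of a subdivision, with the terms of the two halves `[1, 2]` and `[2, x]` and of the
other edge `[1, y]` at the first vertex split off. -/
theorem delta_subdivide {n : ℕ} (x y : Fin (n + 1)) (s : OrientedGraph (n + 1)) :
    delta K (n + 1) (graphClass K (subdivide x ((0, y) ::ₘ s))) =
      graphClass K ((0, x) ::ₘ (0, y) ::ₘ s) +
      edgeTerm K (subdivide x ((0, y) ::ₘ s)) (1, shift x) +
      edgeTerm K (subdivide x ((0, y) ::ₘ s)) (0, shift y) +
      (s.map fun f => edgeTerm K (subdivide x ((0, y) ::ₘ s)) (shiftEdge f)).sum := by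
  rw [delta_graphClass, deltaGraph, ← edgeTerm_subdivide_zero_one]
  conv_lhs => enter [1, 2]; rw [subdivide]
  rw [Multiset.map_cons, Multiset.map_cons, Multiset.map_cons, Multiset.map_cons, Multiset.map_map,
    Multiset.sum_cons, Multiset.sum_cons, Multiset.sum_cons, ← add_assoc, ← add_assoc]
  simp only [shiftEdge, shift_zero, Function.comp_def]

/-- The terms of the homotopy identity that come from an edge away from the first vertex cancel. -/
theorem edgeTerm_subdivide_add {n : ℕ} {x y : Fin (n + 2)} (hx : x ≠ 0) (hy : y ≠ 0)
    {s : OrientedGraph (n + 2)} (hs0 : ∀ f ∈ s, f.1 ≠ 0 ∧ f.2 ≠ 0) (hl : ∀ f ∈ s, f.1 ≠ f.2)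
    {f : Fin (n + 2) × Fin (n + 2)} (hf : f ∈ s) :
    edgeTerm K (subdivide x ((0, y) ::ₘ s)) (shiftEdge f) +
      edgeTerm K (subdivide y ((0, x) ::ₘ s)) (shiftEdge f) +
      homotopy K n (edgeTerm K ((0, x) ::ₘ (0, y) ::ₘ s) f) = 0 := by
  obtain ⟨t, rfl⟩ := Multiset.exists_cons_of_mem hf
  have h := hl f hf
  have hf0 := hs0 f hf
  have hne : ∀ k, k ≠ 0 → std f.1 f.2 h k ≠ 0 := by
    intro k hk hk'
    rw [std_eq_zero_iff] at hk'
    tauto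
  have e : ∀ z, stdEdge f.1 f.2 h (0, z) = (0, std f.1 f.2 h z) :=
    fun z => Prod.ext (std_zero _ _ h) rfl
  rw [Multiset.cons_swap, Multiset.cons_swap (0, x) f, edgeTerm_subdivide_shiftEdge _ h,
    edgeTerm_subdivide_shiftEdge _ h, Multiset.cons_swap (0, x) f, edgeTerm_cons_self h, map_smul,
    homotopy_graphClass, Multiset.map_cons, Multiset.map_cons, Multiset.map_cons,
    Multiset.map_cons, e, e,
    homotopyGraph_cons_cons (hne x hx) (hne y hy)]
  · module
  · intro g hg
    obtain ⟨k, hk, rfl⟩ := Multiset.mem_map.mp hg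
    have := hs0 k (Multiset.mem_cons_of_mem hk)
    exact ⟨hne _ this.1, hne _ this.2⟩

theorem homotopy_identity_normalForm [CharZero K] {n : ℕ} {x y : Fin (n + 2)} (hx : x ≠ 0)
    (hy : y ≠ 0) {s : OrientedGraph (n + 2)} (hs0 : ∀ f ∈ s, f.1 ≠ 0 ∧ f.2 ≠ 0)
    (hG : IsPolygon ((0, x) ::ₘ (0, y) ::ₘ s)) :
    delta K (n + 2) (homotopy K (n + 1) (graphClass K ((0, x) ::ₘ (0, y) ::ₘ s))) +
      homotopy K n (delta K (n + 1) (graphClass K ((0, x) ::ₘ (0, y) ::ₘ s))) =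
    (2 : K) • graphClass K ((0, x) ::ₘ (0, y) ::ₘ s) := by
  have hl : ∀ f ∈ s, f.1 ≠ f.2 := fun f hf =>
    hG.loopless f (Multiset.mem_cons_of_mem (Multiset.mem_cons_of_mem hf))
  have h1 := edgeTerm_subdivide_at_zero (K := K) hx hy hs0 hl (hG.bivalent x)
  have h2 := edgeTerm_subdivide_at_zero (K := K) hy hx hs0 hl (by
    rw [Multiset.cons_swap]; exact hG.bivalent y)
  have h3 : (s.map fun f => edgeTerm K (subdivide x ((0, y) ::ₘ s)) (shiftEdge f) +
      edgeTerm K (subdivide y ((0, x) ::ₘ s)) (shiftEdge f) +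
      homotopy K n (edgeTerm K ((0, x) ::ₘ (0, y) ::ₘ s) f)).sum = 0 := by
    apply Multiset.sum_eq_zero
    intro z hz
    obtain ⟨f, hf, rfl⟩ := Multiset.mem_map.mp hz
    exact edgeTerm_subdivide_add hx hy hs0 hl hf
  rw [Multiset.sum_map_add, Multiset.sum_map_add] at h3
  rw [Multiset.cons_swap (0, y)] at h2
  rw [homotopy_graphClass, homotopyGraph_cons_cons hx hy hs0, map_add, delta_subdivide,
    delta_subdivide, delta_graphClass, deltaGraph, map_multiset_sum, Multiset.map_map,
    Multiset.map_cons, Multiset.map_cons, Multiset.sum_cons, Multiset.sum_cons]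
  simp only [Function.comp_def]
  rw [Multiset.cons_swap (0, y) (0, x)]
  rw [two_smul]
  linear_combination (norm := module) h1 + h2 + h3

/-! ### The homotopy preserves the polygons -/

theorem IsPolygon.swap {n : ℕ} {e : Fin n × Fin n} {s : OrientedGraph n}
    (h : IsPolygon (e ::ₘ s)) : IsPolygon (e.swap ::ₘ s) where
  loopless f hf := by
    rcases Multiset.mem_cons.mp hf with rfl | hf
    · exact (h.loopless e (Multiset.mem_cons_self _ _)).symm
    · exact h.loopless f (Multiset.mem_cons_of_mem hf)
  connected := by
    have hc := h.connected
    unfold IsConnected at hc ⊢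
    convert hc using 1
    ext v w
    obtain ⟨a, b⟩ := e
    simp only [SimpleGraph.fromRel_adj, Multiset.mem_cons, Prod.swap_prod_mk, Prod.mk.injEq]
    tauto
  bivalent v := by
    rw [← h.bivalent v]
    simp only [valency, Multiset.countP_cons, Prod.fst_swap, Prod.snd_swap, or_comm]

theorem IsPolygon.exists_start_eq_zero {n : ℕ} {e : Fin (n + 1) × Fin (n + 1)}
    {s : OrientedGraph (n + 1)} (h : IsPolygon (e ::ₘ s)) (he : e.1 = 0 ∨ e.2 = 0) :
    ∃ x, x ≠ 0 ∧ IsPolygon ((0, x) ::ₘ s) ∧ (graphClass K (e ::ₘ s) = graphClass K ((0, x) ::ₘ s) ∨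
      graphClass K (e ::ₘ s) = - graphClass K ((0, x) ::ₘ s)) := by
  have hl := h.loopless e (Multiset.mem_cons_self _ _)
  obtain ⟨a, b⟩ := e
  rcases he with rfl | rfl
  · exact ⟨b, hl.symm, h, Or.inl rfl⟩
  · exact ⟨a, hl, h.swap, Or.inr (graphClass_swap (0, a) s)⟩

/-- Up to sign, every polygon has exactly two edges at the first vertex, both starting there. -/
theorem IsPolygon.exists_normalForm {n : ℕ} {G : OrientedGraph (n + 1)} (h : IsPolygon G) :
    ∃ (x y : Fin (n + 1)) (s : OrientedGraph (n + 1)), x ≠ 0 ∧ y ≠ 0 ∧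
      (∀ f ∈ s, f.1 ≠ 0 ∧ f.2 ≠ 0) ∧ IsPolygon ((0, x) ::ₘ (0, y) ::ₘ s) ∧
      (graphClass K G = graphClass K ((0, x) ::ₘ (0, y) ::ₘ s) ∨
        graphClass K G = - graphClass K ((0, x) ::ₘ (0, y) ::ₘ s)) := by
  obtain ⟨a, t, ha, rfl, ht⟩ := exists_cons_of_countP_eq_succ _ (h.bivalent 0)
  obtain ⟨b, s, hb, rfl, hs⟩ := exists_cons_of_countP_eq_succ _ ht
  obtain ⟨x, hx, h1, h2⟩ := h.exists_start_eq_zero (K := K) ha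
  rw [Multiset.cons_swap] at h1
  obtain ⟨y, hy, h3, h4⟩ := h1.exists_start_eq_zero (K := K) hb
  rw [Multiset.cons_swap b, Multiset.cons_swap _ (0, x)] at h4
  rw [Multiset.cons_swap] at h3
  refine ⟨x, y, s, hx, hy, valency_eq_zero_iff.mp hs, h3, ?_⟩
  rcases h2 with h2 | h2 <;> rcases h4 with h4 | h4 <;> simp [h2, h4]

theorem IsPolygon.subdivide {n : ℕ} {x : Fin (n + 1)} {s : OrientedGraph (n + 1)}
    (h : IsPolygon ((0, x) ::ₘ s)) : IsPolygon (subdivide x s) where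
  loopless f hf := by
    simp only [SymGraph.subdivide, Multiset.mem_cons, Multiset.mem_map] at hf
    rcases hf with rfl | rfl | ⟨g, hg, rfl⟩
    · simp
    · exact (shift_ne_one x).symm
    · exact shift_ne_shift (h.loopless g (Multiset.mem_cons_of_mem hg))
  connected := by
    have hadj : ∀ v w, v ≠ w → (v, w) ∈ SymGraph.subdivide x s → (SimpleGraph.fromRel fun v w =>
        (v, w) ∈ SymGraph.subdivide x s).Reachable v w := fun v w hne hvw =>
      SimpleGraph.Adj.reachable ((SimpleGraph.fromRel_adj _ _ _).mpr ⟨hne, Or.inl hvw⟩)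
    have h01 := hadj 0 1 (by simp) (by simp [SymGraph.subdivide])
    have h1x := hadj 1 (shift x) (shift_ne_one x).symm (by simp [SymGraph.subdivide])
    have step : ∀ v w, (v, w) ∈ (0, x) ::ₘ s → (SimpleGraph.fromRel fun v w =>
        (v, w) ∈ SymGraph.subdivide x s).Reachable (shift v) (shift w) := by
      intro v w hvw
      rcases Multiset.mem_cons.mp hvw with heq | hs
      · obtain ⟨rfl, rfl⟩ := Prod.mk.inj heq
        rw [shift_zero]
        exact h01.trans h1x
      · exact hadj _ _ (shift_ne_shift (h.loopless _ hvw)) (Multiset.mem_cons_of_mem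
          (Multiset.mem_cons_of_mem (Multiset.mem_map.mpr ⟨(v, w), hs, rfl⟩)))
    have reach : ∀ v w, (SimpleGraph.fromRel fun v w => (v, w) ∈ SymGraph.subdivide x s).Reachable
        (shift v) (shift w) := by
      intro v w
      obtain ⟨p⟩ := h.connected.preconnected v w
      induction p with
      | nil => exact SimpleGraph.Reachable.refl _
      | cons hvw _ ih =>
        refine SimpleGraph.Reachable.trans ?_ ih
        rw [SimpleGraph.fromRel_adj] at hvw
        rcases hvw.2 with h' | h'
        · exact step _ _ h'
        · exact (step _ _ h').symm
    unfold IsConnected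
    rw [SimpleGraph.connected_iff_exists_forall_reachable]
    refine ⟨0, fun w => ?_⟩
    rcases eq_one_or_exists_shift w with rfl | ⟨w, rfl⟩
    · exact h01
    · simpa [shift_zero] using reach 0 w
  bivalent v := by
    rcases eq_one_or_exists_shift v with rfl | ⟨v, rfl⟩
    · have h0 : valency (s.map shiftEdge) 1 = 0 := by
        rw [valency_eq_zero_iff]
        intro e he
        obtain ⟨f, -, rfl⟩ := Multiset.mem_map.mp he
        exact ⟨shift_ne_one _, shift_ne_one _⟩
      rw [valency] at h0
      simp [valency, SymGraph.subdivide, h0]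
    · have h0 : valency (s.map shiftEdge) (shift v) = valency s v := by
        rw [valency, valency, Multiset.countP_map, ← Multiset.countP_eq_card_filter]
        simp only [shiftEdge, shift_injective.eq_iff]
      have h1 : (0 : Fin (n + 2)) = shift v ↔ 0 = v := by
        rw [← shift_injective.eq_iff (a := (0 : Fin (n + 1))), shift_zero]
      have hv := h.bivalent v
      have hl := h.loopless _ (Multiset.mem_cons_self _ _)
      rw [valency] at h0 ⊢
      rw [SymGraph.subdivide, Multiset.countP_cons, Multiset.countP_cons, h0]
      rw [valency, Multiset.countP_cons] at hv
      unfold valency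
      simp only [(shift_ne_one v).symm, h1, shift_injective.eq_iff, or_false, false_or]
      grind

theorem homotopy_mem_polygonSpace {n : ℕ} {z : GraphSpace K (n + 1)}
    (hz : z ∈ polygonSpace K (n + 1)) : homotopy K n z ∈ polygonSpace K (n + 2) := by
  have hle : polygonSpace K (n + 1) ≤ (polygonSpace K (n + 2)).comap (homotopy K n) := by
    rw [polygonSpace, Submodule.span_le]
    rintro _ ⟨G, hG, rfl⟩
    change homotopy K n (graphClass K G) ∈ polygonSpace K (n + 2)
    obtain ⟨x, y, s, hx, hy, hs, h, hc⟩ := hG.exists_normalForm (K := K)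
    have hmem : homotopy K n (graphClass K ((0, x) ::ₘ (0, y) ::ₘ s)) ∈ polygonSpace K (n + 2) := by
      rw [homotopy_graphClass, homotopyGraph_cons_cons hx hy hs]
      refine Submodule.add_mem _ (Submodule.subset_span ⟨_, h.subdivide, rfl⟩)
        (Submodule.subset_span ⟨_, IsPolygon.subdivide ?_, rfl⟩)
      rwa [Multiset.cons_swap]
    rcases hc with hc | hc
    · rwa [hc]
    · rw [hc, map_neg]
      exact Submodule.neg_mem _ hmem
  exact hle hz

/-- On the polygons the homotopy joins twice the identity to zero. -/
theorem homotopy_identity [CharZero K] {n : ℕ} {z : GraphSpace K (n + 2)}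
    (hz : z ∈ polygonSpace K (n + 2)) :
    delta K (n + 2) (homotopy K (n + 1) z) + homotopy K n (delta K (n + 1) z) = (2 : K) • z := by
  have hle : polygonSpace K (n + 2) ≤ LinearMap.eqLocus
      (delta K (n + 2) ∘ₗ homotopy K (n + 1) + homotopy K n ∘ₗ delta K (n + 1))
      ((2 : K) • LinearMap.id) := by
    rw [polygonSpace, Submodule.span_le]
    rintro _ ⟨G, hG, rfl⟩
    obtain ⟨x, y, s, hx, hy, hs, h, hc⟩ := hG.exists_normalForm (K := K)
    have hi := homotopy_identity_normalForm (K := K) hx hy hs h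
    rcases hc with hc | hc
    · rw [hc]
      exact hi
    · rw [hc]
      exact Submodule.neg_mem _ (LinearMap.mem_eqLocus.mpr hi)
  exact hle hz

theorem polygonSpace_eq_bot {n : ℕ} (hn : n ≤ 1) : polygonSpace K n = ⊥ := by
  rw [polygonSpace, Submodule.span_eq_bot]
  rintro _ ⟨G, hG, rfl⟩
  exfalso
  obtain ⟨v⟩ := hG.connected.nonempty
  obtain ⟨e, he, -⟩ := Multiset.countP_pos.mp
    (show 0 < valency G v by rw [hG.bivalent v]; exact two_pos)
  exact hG.loopless e he (Fin.ext (by omega))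

theorem exists_delta_eq [CharZero K] {n : ℕ} {z : GraphSpace K (n + 2)}
    (hz : z ∈ polygonSpace K (n + 2)) (h : delta K (n + 1) z = 0) :
    ∃ w ∈ polygonSpace K (n + 3), delta K (n + 2) w = z := by
  refine ⟨(2 : K)⁻¹ • homotopy K (n + 1) z,
    Submodule.smul_mem _ _ (homotopy_mem_polygonSpace hz), ?_⟩
  have hi := homotopy_identity hz
  rw [h, map_zero, add_zero] at hi
  rw [map_smul, hi, inv_smul_smul₀ two_ne_zero]

theorem polygonComplex_exactAt [CharZero K] (n : ℕ) : (polygonComplex K).ExactAt n := by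
  rcases Nat.lt_or_ge n 2 with hn | hn
  · apply ShortComplex.exact_of_isZero_X₂
    have : Subsingleton (polygonSpace K n) := by
      rw [polygonSpace_eq_bot (by omega)]
      infer_instance
    exact ModuleCat.isZero_of_subsingleton (ModuleCat.of K (polygonSpace K n))
  · obtain ⟨m, rfl⟩ := Nat.exists_eq_add_of_le' hn
    rw [HomologicalComplex.exactAt_iff' _ (m + 3) (m + 2) (m + 1) (ChainComplex.prev _ _)
      (ChainComplex.next_nat_succ _), ShortComplex.moduleCat_exact_iff]
    have hd : ∀ k, (polygonComplex K).d (k + 1) k =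
        ModuleCat.ofHom ((delta K k).restrict (delta_mem_polygonSpace K)) :=
      fun k => ChainComplex.of_d (fun n => ModuleCat.of K (polygonSpace K n))
        (fun n => ModuleCat.ofHom ((delta K n).restrict (delta_mem_polygonSpace K))) k
    intro z hz
    change ((polygonComplex K).d (m + 1 + 1) (m + 1)).hom z = 0 at hz
    rw [hd] at hz
    obtain ⟨w, hw, hwz⟩ := exists_delta_eq z.2 (congrArg Subtype.val hz)
    refine ⟨(⟨w, hw⟩ : polygonSpace K (m + 3)), ?_⟩
    change ((polygonComplex K).d (m + 2 + 1) (m + 2)).hom _ = z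
    rw [hd]
    exact Subtype.ext hwz

end Homotopy

end SymGraph

theorem mainTheorem6 (K : Type*) [Field K] [CharZero K] (n : ℕ) :
    CategoryTheory.Limits.IsZero ((SymGraph.polygonComplex K).homology n) :=
  ((SymGraph.polygonComplex K).exactAt_iff_isZero_homology n).mp
    (SymGraph.polygonComplex_exactAt n)
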